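/- Let $\mathcal M_2$ be the algebra of complex $2\times 2$ matrices and let $R:\mathcal M_2\to\mathcal M_2$ be a bistochastic channel, i.e. a completely positive, trace-preserving linear map with $R(I)=I$. Suppose that $R$ is strictly contractive with contractivity modulus $k\in[0,1)$, i.e. $\|R(\rho)-R(\sigma)\|_1\le k\,\|\rho-\sigma\|_1$ for all density matrices $\rho,\sigma\in\mathcal M_2$, where $\|A\|_1=\operatorname{Tr}\,(A^*A)^{1/2}$. Let $T=R^{\otimes N}$, acting on the operators on $(\mathbb C^2)^{\otimes N}$. Then for every density operator $\rho$ on $(\mathbb C^2)^{\otimes N}$ and every integer $n\ge 1$, $$S(T^n(\rho))-S(\rho)\;\ge\;\frac{1-k^{2n}}{2}\,\bigl\|\rho-I/2^N\bigr\|_2^2,$$ where $S(\rho)=-\operatorname{Tr}(\rho\ln\rho)$ is the von Neumann entropy (natural logarithm, $0\ln 0=0$) and $\|A\|_2=[\operatorname{Tr}(A^*A)]^{1/2}$ is the Hilbert–Schmidt norm. -/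

import Mathlib

namespace QuantumChannel

open scoped ComplexOrder in
/-- A density operator (state) on `ℂ^d`. -/
structure IsState {d : Type*} [Fintype d] (ρ : Matrix d d ℂ) : Prop where
  posSemidef : ρ.PosSemidef
  trace_eq_one : ρ.trace = 1

open scoped MatrixOrder Matrix.Norms.L2Operator CStarAlgebra in
/-- Complete positivity of a linear map between matrix algebras: `T ⊗ id` on
`M_d ⊗ M_k` is positive for every `k` (Mathlib's completely positive maps of C⋆-algebras). -/
def IsCompletelyPositive {d : Type*} [Fintype d] [DecidableEq d]
    (T : Matrix d d ℂ →ₗ[ℂ] Matrix d d ℂ) : Prop :=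
  ∃ Φ : Matrix d d ℂ →CP Matrix d d ℂ, Φ.toLinearMap = T

/-- A quantum channel in the Schrödinger picture: a completely positive and trace-preserving
linear map. -/
structure IsChannel {d : Type*} [Fintype d] [DecidableEq d]
    (T : Matrix d d ℂ →ₗ[ℂ] Matrix d d ℂ) : Prop where
  completelyPositive : IsCompletelyPositive T
  trace_preserving : ∀ X, (T X).trace = X.trace

/-- A bistochastic channel: a channel that is also unital. -/
structure IsBistochastic {d : Type*} [Fintype d] [DecidableEq d]
    (T : Matrix d d ℂ →ₗ[ℂ] Matrix d d ℂ) : Prop extends IsChannel T where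
  map_one : T 1 = 1

/-- The trace norm `‖A‖₁ = Tr (A* A)^{1/2}`. -/
noncomputable def traceNorm {d : Type*} [Fintype d] [DecidableEq d] (A : Matrix d d ℂ) : ℝ :=
  (cfc Real.sqrt (A.conjTranspose * A)).trace.re

/-- The Hilbert–Schmidt norm `‖A‖₂ = [Tr (A* A)]^{1/2}`, which is Mathlib's Frobenius norm. -/
noncomputable def hilbertSchmidtNorm {d : Type*} [Fintype d] (A : Matrix d d ℂ) : ℝ :=
  Matrix.frobeniusNormedAddCommGroup.toNorm.norm A

/-- The channel `T` is strictly contractive with contractivity modulus `k ∈ [0, 1)`. -/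
structure IsStrictlyContractiveWith {d : Type*} [Fintype d] [DecidableEq d]
    (T : Matrix d d ℂ →ₗ[ℂ] Matrix d d ℂ) (k : ℝ) : Prop where
  nonneg : 0 ≤ k
  lt_one : k < 1
  contract : ∀ ρ σ : Matrix d d ℂ, IsState ρ → IsState σ →
    traceNorm (T ρ - T σ) ≤ k * traceNorm (ρ - σ)

/-- The von Neumann entropy `S(ρ) = -Tr (ρ ln ρ)`, with the natural logarithm. Here `ln ρ` is the
functional calculus of the Hermitian matrix `ρ`, and `Real.log 0 = 0` gives the usual convention
`0 ln 0 = 0`. -/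
noncomputable def vonNeumannEntropy {d : Type*} [Fintype d] [DecidableEq d]
    (ρ : Matrix d d ℂ) : ℝ :=
  -(ρ * cfc Real.log ρ).trace.re

/-- The elementary tensor `A₁ ⊗ ⋯ ⊗ A_N`, as an operator on `(ℂ^d)^{⊗N}`, whose standard basis is
indexed by the functions `Fin N → d`. -/
def tensorProd {d : Type*} {N : ℕ} (A : Fin N → Matrix d d ℂ) :
    Matrix (Fin N → d) (Fin N → d) ℂ :=
  Matrix.of fun i j => ∏ l, A l (i l) (j l)

/-- The tensor power `R^{⊗N}` of a linear map `R` on `M_d`: the linear map that sends each matrix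
unit `E_{a b} = E_{a₁ b₁} ⊗ ⋯ ⊗ E_{a_N b_N}` to `R(E_{a₁ b₁}) ⊗ ⋯ ⊗ R(E_{a_N b_N})`. -/
def tensorPower {d : Type*} [Fintype d] [DecidableEq d] (N : ℕ)
    (R : Matrix d d ℂ →ₗ[ℂ] Matrix d d ℂ) :
    Matrix (Fin N → d) (Fin N → d) ℂ →ₗ[ℂ] Matrix (Fin N → d) (Fin N → d) ℂ where
  toFun X := ∑ a, ∑ b, X a b • tensorProd fun l => R (Matrix.single (a l) (b l) 1)
  map_add' X Y := by simp [add_smul, Finset.sum_add_distrib]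
  map_smul' c X := by simp [mul_smul, Finset.smul_sum]

/-- `R^{⊗N}` acts on elementary tensors by `A₁ ⊗ ⋯ ⊗ A_N ↦ R(A₁) ⊗ ⋯ ⊗ R(A_N)`. -/
theorem tensorPower_tensorProd {d : Type*} [Fintype d] [DecidableEq d] (N : ℕ)
    (R : Matrix d d ℂ →ₗ[ℂ] Matrix d d ℂ) (A : Fin N → Matrix d d ℂ) :
    tensorPower N R (tensorProd A) = tensorProd fun l => R (A l) := by
  have key : ∀ l : Fin N, R (A l) =
      ∑ p : d × d, A l p.1 p.2 • R (Matrix.single p.1 p.2 1) := by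
    intro l
    conv_lhs => rw [Matrix.matrix_eq_sum_single (A l)]
    simp only [map_sum, Fintype.sum_prod_type]
    refine Finset.sum_congr rfl fun i _ => Finset.sum_congr rfl fun j _ => ?_
    rw [← map_smul, Matrix.smul_single, smul_eq_mul, mul_one]
  ext i j
  have h1 : tensorProd (fun l => R (A l)) i j = ∏ l, ∑ p : d × d,
      A l p.1 p.2 * R (Matrix.single p.1 p.2 1) (i l) (j l) := by
    simp only [tensorProd, Matrix.of_apply]
    refine Finset.prod_congr rfl fun l _ => ?_
    conv_lhs => rw [key l]
    simp [Matrix.sum_apply]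
  rw [h1, Finset.prod_univ_sum, Fintype.piFinset_univ]
  have h2 : tensorPower N R (tensorProd A) i j =
      ∑ q : (Fin N → d) × (Fin N → d), ∏ l,
        (A l (q.1 l) (q.2 l) * R (Matrix.single (q.1 l) (q.2 l) 1) (i l) (j l)) := by
    simp [tensorPower, tensorProd, Matrix.sum_apply, Fintype.sum_prod_type,
      Finset.prod_mul_distrib]
  rw [h2]
  exact (Equiv.sum_comp (Equiv.arrowProdEquivProdArrow (Fin N) (fun _ => d) (fun _ => d))
    (fun q => ∏ l, (A l (q.1 l) (q.2 l) *
      R (Matrix.single (q.1 l) (q.2 l) 1) (i l) (j l)))).symm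

end QuantumChannel

/-!
The entropy production of `T = R^{⊗N}` is bounded by combining two facts.

The first is an entropy–purity inequality for a positive, unital, trace-preserving map `Φ`. The
eigenvalues of `Φ ρ` are the image of those of `ρ` under a doubly stochastic matrix, so
`∑ f(λⱼ)` does not increase for convex `f` (`sum_convexOn_eigenvalues_le`). For
`f x = x ln x - x² / 2`, which is convex on `[0, 1]`, this says that
`S(Φ ρ) - S(ρ) ≥ (‖ρ‖₂² - ‖Φ ρ‖₂²) / 2` (`vonNeumannEntropy_sub_ge`). It applies to `Φ = Tⁿ`:
positivity of `T` follows from a Kraus representation of `R`.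

The second is that `T` contracts the Hilbert–Schmidt norm of traceless operators by `k`. For one
qubit, the trace norm of a traceless Hermitian matrix is `√2` times its Hilbert–Schmidt norm, so
contractivity on states gives `R* R ≤ k² + (1 - k²) E`, where `R*` is the Hilbert–Schmidt adjoint
and `E` the projection onto the multiples of the identity. This operator inequality is stable under
tensor powers (`sum_normSq_tensorProd_mulVec_le`). Since `Tⁿ` fixes `I / 2^N`, and `‖ρ‖₂²` and
`‖ρ - I / 2^N‖₂²` differ by `1 / 2^N`, the two facts together give the bound.
-/

namespace QuantumChannel

open Matrix
open scoped ComplexOrder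

/-! ### Kraus operators and positivity of tensor powers -/

/-- Stated for an abstract C⋆-algebra with any star order, so that it applies to `CStarMatrix`, for
which instance search does not find the functional calculus by itself. -/
theorem exists_star_mul_self_of_nonneg {A : Type*} [CStarAlgebra A] [PartialOrder A]
    [StarOrderedRing A] {a : A} (ha : 0 ≤ a) : ∃ b, a = star b * b :=
  CStarAlgebra.nonneg_iff_eq_star_mul_self.mp ha

open scoped MatrixOrder Matrix.Norms.L2Operator CStarAlgebra in
/-- Existence of a Kraus representation `R X = ∑ₘ Vₘᴴ X Vₘ`, written on matrix units. Complete
positivity makes the block matrix `(R E_{ab})_{a,b}` nonnegative, hence of the form `y* y`, and the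
Kraus operator with index `(c, m)` consists of the `m`-th rows of the blocks `y_{ca}`. -/
theorem IsCompletelyPositive.exists_kraus {d : Type*} [Fintype d] [DecidableEq d] [Nonempty d]
    {R : Matrix d d ℂ →ₗ[ℂ] Matrix d d ℂ} (hR : IsCompletelyPositive R) :
    ∃ V : d × d → Matrix d d ℂ, ∀ a b i j,
      R (Matrix.single a b 1) i j = ∑ m, star (V m a i) * V m b j := by
  obtain ⟨Φ, rfl⟩ := hR
  obtain ⟨o⟩ := ‹Nonempty d›
  -- `star x * x` is the block matrix whose `(a, b)` entry is the matrix unit `E_{ab}`.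
  let x : CStarMatrix d d (Matrix d d ℂ) :=
    CStarMatrix.ofMatrix fun c b => if c = o then Matrix.single o b 1 else 0
  have hx' (c b : d) : x c b = if c = o then Matrix.single o b 1 else 0 := rfl
  obtain ⟨y, hy⟩ := exists_star_mul_self_of_nonneg
    (Φ.map_cstarMatrix_nonneg (star x * x) (star_mul_self_nonneg x))
  refine ⟨fun m => Matrix.of fun a i => y m.1 a m.2 i, fun a b i j => ?_⟩
  have hx : (star x * x) a b = Matrix.single a b 1 := by
    rw [CStarMatrix.mul_apply, Finset.sum_eq_single o]
    · rw [CStarMatrix.star_apply]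
      simp [hx', Matrix.star_eq_conjTranspose]
    · intro c _ hc
      simp [hx', hc]
    · simp
  have h := congrArg (fun z : CStarMatrix d d (Matrix d d ℂ) => z a b i j) hy
  simp only [CStarMatrix.map_apply, hx, CStarMatrix.mul_apply, CStarMatrix.star_apply] at h
  change Φ (Matrix.single a b 1) i j = _
  rw [h, Matrix.sum_apply, Fintype.sum_prod_type]
  simp [Matrix.mul_apply, Matrix.star_eq_conjTranspose]

/-- The Kraus operators of `R^{⊗N}` are the elementary tensors of Kraus operators of `R`. -/
theorem tensorPower_eq_sum_kraus {d ι : Type*} [Fintype d] [DecidableEq d] [Fintype ι]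
    {R : Matrix d d ℂ →ₗ[ℂ] Matrix d d ℂ} {V : ι → Matrix d d ℂ}
    (hV : ∀ a b i j, R (Matrix.single a b 1) i j = ∑ m, star (V m a i) * V m b j)
    (N : ℕ) (X : Matrix (Fin N → d) (Fin N → d) ℂ) :
    tensorPower N R X = ∑ m : Fin N → ι,
      (tensorProd fun l => V (m l)).conjTranspose * X * tensorProd fun l => V (m l) := by
  classical
  ext i j
  simp only [tensorPower, LinearMap.coe_mk, AddHom.coe_mk, Matrix.sum_apply, Matrix.smul_apply,
    tensorProd, Matrix.of_apply, hV, smul_eq_mul, Finset.prod_univ_sum, Fintype.piFinset_univ,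
    Matrix.mul_apply, Matrix.conjTranspose_apply, Finset.prod_mul_distrib, Finset.mul_sum,
    Finset.sum_mul, star_prod]
  rw [Finset.sum_comm]
  refine Eq.trans (Finset.sum_congr rfl fun b _ => Finset.sum_comm) ?_
  rw [Finset.sum_comm]
  refine Finset.sum_congr rfl fun m _ => Finset.sum_congr rfl fun b _ =>
    Finset.sum_congr rfl fun a _ => ?_
  ring

theorem IsCompletelyPositive.tensorPower_posSemidef {d : Type*} [Fintype d] [DecidableEq d]
    [Nonempty d] {R : Matrix d d ℂ →ₗ[ℂ] Matrix d d ℂ} (hR : IsCompletelyPositive R)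
    {N : ℕ} {X : Matrix (Fin N → d) (Fin N → d) ℂ} (hX : X.PosSemidef) :
    (tensorPower N R X).PosSemidef := by
  obtain ⟨V, hV⟩ := hR.exists_kraus
  rw [tensorPower_eq_sum_kraus hV]
  exact Matrix.posSemidef_sum _ fun m _ => hX.conjTranspose_mul_mul_same _

theorem IsCompletelyPositive.map_conjTranspose {d : Type*} [Fintype d] [DecidableEq d]
    [Nonempty d] {R : Matrix d d ℂ →ₗ[ℂ] Matrix d d ℂ} (hR : IsCompletelyPositive R)
    (X : Matrix d d ℂ) : R X.conjTranspose = (R X).conjTranspose := by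
  obtain ⟨V, hV⟩ := hR.exists_kraus
  have key (Y : Matrix d d ℂ) (i j) : R Y i j = ∑ a, ∑ b, Y a b * R (Matrix.single a b 1) i j := by
    conv_lhs => rw [Matrix.matrix_eq_sum_single Y]
    simp only [map_sum, Matrix.sum_apply]
    refine Finset.sum_congr rfl fun a _ => Finset.sum_congr rfl fun b _ => ?_
    rw [← smul_eq_mul, ← Matrix.smul_apply, ← map_smul, Matrix.smul_single, smul_eq_mul, mul_one]
  ext i j
  rw [Matrix.conjTranspose_apply, key, key, star_sum, Finset.sum_comm]
  refine Finset.sum_congr rfl fun b _ => ?_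
  rw [star_sum]
  refine Finset.sum_congr rfl fun a _ => ?_
  simp [hV, mul_comm]

/-! ### Unit and trace under tensor powers -/

theorem tensorPower_one {d : Type*} [Fintype d] [DecidableEq d] (N : ℕ)
    {R : Matrix d d ℂ →ₗ[ℂ] Matrix d d ℂ} (hR : R 1 = 1) : tensorPower N R 1 = 1 := by
  have h : (1 : Matrix (Fin N → d) (Fin N → d) ℂ) = tensorProd fun _ => 1 := by
    ext i j
    simp [tensorProd, Matrix.one_apply, Finset.prod_ite_zero, funext_iff]
  conv_lhs => rw [h, tensorPower_tensorProd]
  simp only [hR, h]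

theorem trace_tensorProd {d : Type*} [Fintype d] {N : ℕ} (A : Fin N → Matrix d d ℂ) :
    (tensorProd A).trace = ∏ l, (A l).trace := by
  classical
  simp [Matrix.trace, tensorProd, Finset.prod_univ_sum]

theorem trace_tensorPower {d : Type*} [Fintype d] [DecidableEq d] (N : ℕ)
    {R : Matrix d d ℂ →ₗ[ℂ] Matrix d d ℂ} (hR : ∀ X, (R X).trace = X.trace)
    (X : Matrix (Fin N → d) (Fin N → d) ℂ) : (tensorPower N R X).trace = X.trace := by
  have h (a b : Fin N → d) :
      ∏ l, (Matrix.single (a l) (b l) (1 : ℂ)).trace = if a = b then 1 else 0 := by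
    simp only [Matrix.trace, Matrix.diag_apply, Matrix.single_apply]
    have (l : Fin N) : (∑ i, if a l = i ∧ b l = i then (1 : ℂ) else 0)
        = if a l = b l then 1 else 0 := by
      rw [Finset.sum_eq_single (a l)] <;> simp +contextual [eq_comm]
    simp [this, Finset.prod_ite_zero, funext_iff]
  simp [tensorPower, Matrix.trace_sum, Matrix.trace_smul, trace_tensorProd, hR, h,
    -Matrix.trace_single_eq_same]
  rfl

/-! ### Traces and eigenvalues -/

section Spectral

variable {d : Type*} [Fintype d] [DecidableEq d]

theorem trace_cfc {A : Matrix d d ℂ} (hA : A.IsHermitian) (f : ℝ → ℝ) :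
    (cfc f A).trace = ((∑ i, f (hA.eigenvalues i) : ℝ) : ℂ) := by
  rw [hA.cfc_eq, Matrix.IsHermitian.cfc, Unitary.conjStarAlgAut_apply, Matrix.trace_mul_cycle]
  simp [Matrix.trace]

theorem vonNeumannEntropy_eq_sum {ρ : Matrix d d ℂ} (hρ : ρ.IsHermitian) :
    vonNeumannEntropy ρ = -∑ i, hρ.eigenvalues i * Real.log (hρ.eigenvalues i) := by
  have hfin : (spectrum ℝ ρ).Finite := Matrix.finite_real_spectrum
  have h : ρ * cfc Real.log ρ = cfc (fun x => x * Real.log x) ρ := by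
    rw [cfc_mul (fun x : ℝ => x) Real.log ρ (hfin.continuousOn _) (hfin.continuousOn _),
      cfc_id' ℝ ρ hρ.isSelfAdjoint]
  rw [vonNeumannEntropy, h, trace_cfc hρ, Complex.ofReal_re]

theorem hilbertSchmidtNorm_sq {m : Type*} [Fintype m] (A : Matrix m m ℂ) :
    hilbertSchmidtNorm A ^ 2 = ∑ i, ∑ j, ‖A i j‖ ^ 2 := by
  have h := Matrix.frobenius_norm_def A
  rw [hilbertSchmidtNorm]
  rw [h, ← Real.sqrt_eq_rpow, Real.sq_sqrt (by positivity)]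
  simp

theorem hilbertSchmidtNorm_sq_eq_trace {m : Type*} [Fintype m] (A : Matrix m m ℂ) :
    ((hilbertSchmidtNorm A ^ 2 : ℝ) : ℂ) = (A.conjTranspose * A).trace := by
  rw [hilbertSchmidtNorm_sq, Finset.sum_comm]
  simp [Matrix.trace, Matrix.mul_apply, Complex.conj_mul']

theorem hilbertSchmidtNorm_sq_eq_sum {A : Matrix d d ℂ} (hA : A.IsHermitian) :
    hilbertSchmidtNorm A ^ 2 = ∑ i, hA.eigenvalues i ^ 2 := by
  have h : A * A = cfc (fun x : ℝ => x * x) A := by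
    rw [cfc_mul (fun x : ℝ => x) (fun x : ℝ => x) A, cfc_id' ℝ A hA.isSelfAdjoint]
  apply Complex.ofReal_injective
  rw [hilbertSchmidtNorm_sq_eq_trace, hA.eq, h, trace_cfc hA]
  simp [sq]

/-- The rank-one projection `|uⱼ⟩⟨uⱼ|` onto the `j`-th vector of the eigenbasis of `A`. -/
noncomputable def eigenProj {A : Matrix d d ℂ} (hA : A.IsHermitian) (j : d) : Matrix d d ℂ :=
  Matrix.vecMulVec (hA.eigenvectorBasis j) (star (hA.eigenvectorBasis j : d → ℂ))

theorem posSemidef_eigenProj {A : Matrix d d ℂ} (hA : A.IsHermitian) (j : d) :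
    (eigenProj hA j).PosSemidef :=
  Matrix.posSemidef_vecMulVec_self_star _

theorem sum_eigenProj {A : Matrix d d ℂ} (hA : A.IsHermitian) :
    ∑ j, eigenProj hA j = 1 := by
  have h := Unitary.mul_star_self_of_mem hA.eigenvectorUnitary.2
  rw [← h]
  ext a b
  simp [eigenProj, Matrix.sum_apply, Matrix.mul_apply, Matrix.vecMulVec_apply,
    Matrix.star_eq_conjTranspose]

theorem sum_eigenvalues_smul_eigenProj {A : Matrix d d ℂ} (hA : A.IsHermitian) :
    ∑ j, (hA.eigenvalues j : ℂ) • eigenProj hA j = A := by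
  conv_rhs => rw [hA.spectral_theorem, Unitary.conjStarAlgAut_apply]
  ext a b
  simp [eigenProj, Matrix.sum_apply, Matrix.mul_apply, Matrix.vecMulVec_apply,
    Matrix.star_eq_conjTranspose, Matrix.diagonal_apply]
  refine Finset.sum_congr rfl fun j _ => ?_
  ring

theorem trace_eigenProj {A : Matrix d d ℂ} (hA : A.IsHermitian) (j : d) :
    (eigenProj hA j).trace = 1 := by
  have h : inner ℂ (hA.eigenvectorBasis j) (hA.eigenvectorBasis j) = 1 := by
    rw [inner_self_eq_norm_sq_to_K, hA.eigenvectorBasis.orthonormal.1 j]; simp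
  rw [eigenProj, Matrix.trace_vecMulVec, ← h, EuclideanSpace.inner_eq_star_dotProduct]

/-- The `i`-th eigenvalue as the expectation `⟨uᵢ, A uᵢ⟩ = Tr(|uᵢ⟩⟨uᵢ| A)`. -/
theorem eigenvalues_eq_trace {A : Matrix d d ℂ} (hA : A.IsHermitian) (i : d) :
    (eigenProj hA i * A).trace = hA.eigenvalues i := by
  rw [eigenProj, Matrix.vecMulVec_mul, Matrix.trace_vecMulVec, dotProduct_comm,
    ← Matrix.dotProduct_mulVec, hA.mulVec_eigenvectorBasis, dotProduct_comm]
  have h := trace_eigenProj hA i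
  rw [eigenProj, Matrix.trace_vecMulVec] at h
  rw [smul_dotProduct, h]
  simp

/-! ### Entropy and purity -/

/-- A positive, unital, trace-preserving map does not increase `∑ f(λⱼ)` for convex `f`: the
eigenvalues of `Φ A` are obtained from those of `A` by a doubly stochastic matrix. -/
theorem sum_convexOn_eigenvalues_le {Φ : Matrix d d ℂ →ₗ[ℂ] Matrix d d ℂ}
    (hpos : ∀ X : Matrix d d ℂ, X.PosSemidef → (Φ X).PosSemidef)
    (htr : ∀ X, (Φ X).trace = X.trace) (hone : Φ 1 = 1)
    {A : Matrix d d ℂ} (hA : A.IsHermitian) (hΦA : (Φ A).IsHermitian)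
    {s : Set ℝ} {f : ℝ → ℝ} (hf : ConvexOn ℝ s f) (hs : ∀ j, hA.eigenvalues j ∈ s) :
    ∑ i, f (hΦA.eigenvalues i) ≤ ∑ j, f (hA.eigenvalues j) := by
  -- `D i j = ⟨vᵢ, Φ(|uⱼ⟩⟨uⱼ|) vᵢ⟩` for the eigenvectors `vᵢ` of `Φ A` and `uⱼ` of `A`.
  let D (i j : d) : ℝ := ((eigenProj hΦA i) * Φ (eigenProj hA j)).trace.re
  have hnn (i j : d) : 0 ≤ ((eigenProj hΦA i) * Φ (eigenProj hA j)).trace := by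
    rw [eigenProj, Matrix.vecMulVec_mul, Matrix.trace_vecMulVec, dotProduct_comm,
      ← Matrix.dotProduct_mulVec]
    exact (hpos _ (posSemidef_eigenProj hA j)).dotProduct_mulVec_nonneg _
  have hD0 (i j : d) : 0 ≤ D i j := (Complex.le_def.1 (hnn i j)).1
  have hrow (i : d) : ∑ j, D i j = 1 := by
    simp only [D, ← Complex.re_sum, ← Matrix.trace_sum, ← Finset.mul_sum, ← map_sum,
      sum_eigenProj, hone, mul_one, trace_eigenProj, Complex.one_re]
  have hcol (j : d) : ∑ i, D i j = 1 := by
    simp only [D, ← Complex.re_sum, ← Matrix.trace_sum, ← Finset.sum_mul,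
      sum_eigenProj, one_mul, htr, trace_eigenProj, Complex.one_re]
  have hval (i : d) : hΦA.eigenvalues i = ∑ j, D i j • hA.eigenvalues j := by
    have hA' : Φ A = ∑ j, (hA.eigenvalues j : ℂ) • Φ (eigenProj hA j) := by
      simp only [← map_smul, ← map_sum, sum_eigenvalues_smul_eigenProj]
    have h := congrArg (fun X => (eigenProj hΦA i * X).trace.re) hA'
    simp only [eigenvalues_eq_trace, Complex.ofReal_re] at h
    rw [h]
    simp [D, Finset.mul_sum, Matrix.trace_sum, Matrix.trace_smul, mul_comm]
  calc ∑ i, f (hΦA.eigenvalues i) ≤ ∑ i, ∑ j, D i j • f (hA.eigenvalues j) := by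
        refine Finset.sum_le_sum fun i _ => ?_
        rw [hval i]
        exact hf.map_sum_le (fun j _ => hD0 i j) (hrow i) fun j _ => hs j
    _ = ∑ j, f (hA.eigenvalues j) := by
        rw [Finset.sum_comm]
        simp only [smul_eq_mul, ← Finset.sum_mul, hcol, one_mul]

/-- The second derivative is `1/x - 1`, which is nonnegative exactly because `x ≤ 1`. -/
theorem convexOn_mul_log_sub_sq :
    ConvexOn ℝ (Set.Icc 0 1) fun x : ℝ => x * Real.log x - x ^ 2 / 2 := by
  have hd : ∀ x ∈ Set.Ioo (0 : ℝ) 1,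
      HasDerivAt (fun x : ℝ => x * Real.log x - x ^ 2 / 2) (Real.log x + 1 - x) x := by
    intro x hx
    have h := (Real.hasDerivAt_mul_log hx.1.ne').sub (((hasDerivAt_id x).pow 2).div_const 2)
    exact h.congr_deriv (by simp)
  have hd2 : ∀ x ∈ Set.Ioo (0 : ℝ) 1,
      HasDerivAt (fun x : ℝ => Real.log x + 1 - x) (x⁻¹ - 1) x := fun x hx =>
    ((Real.hasDerivAt_log hx.1.ne').add_const 1).sub (hasDerivAt_id x)
  refine convexOn_of_hasDerivWithinAt2_nonneg (convex_Icc 0 1)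
    (f' := fun x => Real.log x + 1 - x) (f'' := fun x => x⁻¹ - 1) ?_ ?_ ?_ ?_
  · exact (Real.continuous_mul_log.sub (by fun_prop)).continuousOn
  · rw [interior_Icc]; exact fun x hx => (hd x hx).hasDerivWithinAt
  · rw [interior_Icc]; exact fun x hx => (hd2 x hx).hasDerivWithinAt
  · rw [interior_Icc]
    exact fun x hx => sub_nonneg.2 ((one_le_inv₀ hx.1).2 hx.2.le)

/-- The entropy gained under a positive, unital, trace-preserving map is at least half the purity
lost. -/
theorem vonNeumannEntropy_sub_ge {Φ : Matrix d d ℂ →ₗ[ℂ] Matrix d d ℂ}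
    (hpos : ∀ X : Matrix d d ℂ, X.PosSemidef → (Φ X).PosSemidef)
    (htr : ∀ X, (Φ X).trace = X.trace) (hone : Φ 1 = 1)
    {ρ : Matrix d d ℂ} (hρ : IsState ρ) :
    (hilbertSchmidtNorm ρ ^ 2 - hilbertSchmidtNorm (Φ ρ) ^ 2) / 2 ≤
      vonNeumannEntropy (Φ ρ) - vonNeumannEntropy ρ := by
  have hH := hρ.posSemidef.isHermitian
  have hΦH := (hpos _ hρ.posSemidef).isHermitian
  have hsum : ∑ j, hH.eigenvalues j = 1 := by
    have h := hH.trace_eq_sum_eigenvalues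
    rw [hρ.trace_eq_one] at h
    simpa using (congrArg Complex.re h).symm
  have hmem (j : d) : hH.eigenvalues j ∈ Set.Icc (0 : ℝ) 1 :=
    ⟨hρ.posSemidef.eigenvalues_nonneg j, hsum ▸ Finset.single_le_sum
      (fun i _ => hρ.posSemidef.eigenvalues_nonneg i) (Finset.mem_univ j)⟩
  have h := sum_convexOn_eigenvalues_le hpos htr hone hH hΦH convexOn_mul_log_sub_sq hmem
  simp only [Finset.sum_sub_distrib, ← Finset.sum_div] at h
  rw [vonNeumannEntropy_eq_sum hH, vonNeumannEntropy_eq_sum hΦH, hilbertSchmidtNorm_sq_eq_sum hH,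
    hilbertSchmidtNorm_sq_eq_sum hΦH]
  linarith

theorem hilbertSchmidtNorm_sub_smul_one_sq {ρ : Matrix d d ℂ} (hρ : ρ.trace = 1) :
    hilbertSchmidtNorm (ρ - ((1 : ℂ) / Fintype.card d) • 1) ^ 2 =
      hilbertSchmidtNorm ρ ^ 2 - 1 / Fintype.card d := by
  have hd : (Fintype.card d : ℂ) ≠ 0 := by
    intro h
    have : IsEmpty d := Fintype.card_eq_zero_iff.1 (by exact_mod_cast h)
    simp [Matrix.trace] at hρ
  apply Complex.ofReal_injective
  push_cast [hilbertSchmidtNorm_sq_eq_trace]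
  have h := hilbertSchmidtNorm_sq_eq_trace (ρ - ((1 : ℂ) / Fintype.card d) • 1)
  have h' := hilbertSchmidtNorm_sq_eq_trace ρ
  push_cast at h h'
  rw [h, h']
  simp only [Matrix.conjTranspose_sub, Matrix.conjTranspose_smul, Matrix.conjTranspose_one,
    sub_mul, mul_sub, Matrix.trace_sub, Matrix.smul_mul, Matrix.mul_smul, one_mul, mul_one,
    Matrix.trace_smul, Matrix.trace_one, Matrix.trace_conjTranspose, hρ, smul_eq_mul]
  simp
  field_simp
  ring

end Spectral

/-! ### Tensor powers of contractions -/

/-- Pythagoras for the component of `z` along the unit vector `e`. -/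
theorem sum_normSq_eq_add {P : Type*} [Fintype P] {e : P → ℂ} (he : ∑ p, ‖e p‖ ^ 2 = 1)
    (z : P → ℂ) :
    ∑ p, ‖z p‖ ^ 2 = ∑ p, ‖z p - e p * ∑ q, star (e q) * z q‖ ^ 2 +
      ‖∑ q, star (e q) * z q‖ ^ 2 := by
  set w := ∑ q, star (e q) * z q with hw
  have he' : ∑ p, star (e p) * e p = 1 := by
    have := congrArg (fun t : ℝ => (t : ℂ)) he
    simpa [Complex.conj_mul'] using this
  have hw' : ∑ q, e q * star (z q) = star w := by
    rw [hw, star_sum]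
    simp
  apply Complex.ofReal_injective
  push_cast
  simp only [← Complex.conj_mul']
  simp only [← starRingEnd_apply] at hw he' hw' ⊢
  simp only [map_sub, map_mul]
  have : ∀ p, (starRingEnd ℂ (z p) - starRingEnd ℂ (e p) * starRingEnd ℂ w) * (z p - e p * w)
      = starRingEnd ℂ (z p) * z p - w * (e p * starRingEnd ℂ (z p))
        - starRingEnd ℂ w * (starRingEnd ℂ (e p) * z p)
        + starRingEnd ℂ w * w * (starRingEnd ℂ (e p) * e p) := fun p => by ring
  simp only [this, Finset.sum_add_distrib, Finset.sum_sub_distrib, ← Finset.mul_sum, he', ← hw,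
    hw']
  ring

theorem sum_fin_succ_pi {P M : Type*} [Fintype P] [AddCommMonoid M] {N : ℕ}
    (f : (Fin (N + 1) → P) → M) :
    ∑ p, f p = ∑ p₀, ∑ p : Fin N → P, f (Fin.cons p₀ p) :=
  ((Fin.consEquiv fun _ => P).sum_comp f).symm.trans (Fintype.sum_prod_type _)

theorem tensorProd_mulVec_cons {P : Type*} [Fintype P] {N : ℕ} (r : Matrix P P ℂ)
    (x : (Fin (N + 1) → P) → ℂ) (p₀ : P) (p : Fin N → P) :
    (tensorProd (fun _ => r) *ᵥ x) (Fin.cons p₀ p) =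
      ∑ q₀, r p₀ q₀ * (tensorProd (fun _ => r) *ᵥ fun q => x (Fin.cons q₀ q)) p := by
  simp only [mulVec, dotProduct, sum_fin_succ_pi, tensorProd, Matrix.of_apply,
    Fin.prod_univ_succ, Fin.cons_zero, Fin.cons_succ, Finset.mul_sum, mul_assoc]

/-- If `r* r ≤ c + (1 - c) |e⟩⟨e|` for a unit vector `e` and `0 ≤ c ≤ 1`, then `r^{⊗N}` is a
contraction and satisfies the same bound with `e^{⊗N}` in place of `e`. -/
theorem sum_normSq_tensorProd_mulVec_le {P : Type*} [Fintype P] {r : Matrix P P ℂ} {e : P → ℂ}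
    (he : ∑ p, ‖e p‖ ^ 2 = 1) {c : ℝ} (hc0 : 0 ≤ c) (hc1 : c ≤ 1)
    (hr : ∀ z : P → ℂ, ∑ p, ‖(r *ᵥ z) p‖ ^ 2 ≤
      c * ∑ p, ‖z p‖ ^ 2 + (1 - c) * ‖∑ q, star (e q) * z q‖ ^ 2)
    (N : ℕ) (x : (Fin N → P) → ℂ) :
    ∑ p, ‖(tensorProd (fun _ : Fin N => r) *ᵥ x) p‖ ^ 2 ≤ ∑ p, ‖x p‖ ^ 2 ∧
    ∑ p, ‖(tensorProd (fun _ : Fin N => r) *ᵥ x) p‖ ^ 2 ≤ c * ∑ p, ‖x p‖ ^ 2 +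
      (1 - c) * ‖∑ q : Fin N → P, (∏ l, star (e (q l))) * x q‖ ^ 2 := by
  induction N with
  | zero =>
    have h : tensorProd (fun _ : Fin 0 => r) *ᵥ x = x := by
      ext p
      simp [mulVec, dotProduct, tensorProd, Subsingleton.elim p default]
    rw [h]
    refine ⟨le_rfl, ?_⟩
    simp only [Finset.univ_unique, Finset.sum_singleton, Finset.univ_eq_empty, Finset.prod_empty,
      one_mul]
    linarith
  | succ N ih =>
    -- In the first tensor factor, `x` splits into `e ⊗ w`, on which the bound for `r` gives factor
    -- `1`, and the part orthogonal to `e`, with slices `s q₀ - e q₀ • w` and factor `c`.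
    -- The sharp induction hypothesis is used on `w` only; contractivity suffices for the rest.
    let s (q₀ : P) (q : Fin N → P) : ℂ := x (Fin.cons q₀ q)
    let w (q : Fin N → P) : ℂ := ∑ q₀, star (e q₀) * s q₀ q
    let T (y : (Fin N → P) → ℂ) : (Fin N → P) → ℂ := tensorProd (fun _ : Fin N => r) *ᵥ y
    have hTw (p : Fin N → P) : ∑ q₀, star (e q₀) * T (s q₀) p = T w p := by
      simp only [T, w, mulVec, dotProduct, Finset.mul_sum]
      rw [Finset.sum_comm]
      exact Finset.sum_congr rfl fun _ _ => Finset.sum_congr rfl fun _ _ => by ring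
    have hTs (q₀ : P) (p : Fin N → P) :
        T (s q₀) p - e q₀ * T w p = T (fun q => s q₀ q - e q₀ * w q) p := by
      simp only [T, mulVec, dotProduct, Finset.mul_sum, ← Finset.sum_sub_distrib]
      exact Finset.sum_congr rfl fun _ _ => by ring
    have hx : ∑ p, ‖x p‖ ^ 2 =
        ∑ q₀, ∑ q, ‖s q₀ q - e q₀ * w q‖ ^ 2 + ∑ q, ‖w q‖ ^ 2 := by
      rw [sum_fin_succ_pi, Finset.sum_comm, Finset.sum_comm (γ := P), ← Finset.sum_add_distrib]
      exact Finset.sum_congr rfl fun q _ => sum_normSq_eq_add he fun q₀ => s q₀ q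
    have hw : ∑ q : Fin (N + 1) → P, (∏ l, star (e (q l))) * x q =
        ∑ q : Fin N → P, (∏ l, star (e (q l))) * w q := by
      simp only [sum_fin_succ_pi, Fin.prod_univ_succ, Fin.cons_zero, Fin.cons_succ, w,
        Finset.mul_sum]
      rw [Finset.sum_comm]
      exact Finset.sum_congr rfl fun _ _ => Finset.sum_congr rfl fun _ _ => by ring
    have hstep : ∑ p, ‖(tensorProd (fun _ : Fin (N + 1) => r) *ᵥ x) p‖ ^ 2 ≤
        c * ∑ q₀, ∑ q, ‖s q₀ q - e q₀ * w q‖ ^ 2 + ∑ p, ‖T w p‖ ^ 2 := by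
      calc ∑ p, ‖(tensorProd (fun _ : Fin (N + 1) => r) *ᵥ x) p‖ ^ 2
          = ∑ p : Fin N → P, ∑ p₀, ‖(r *ᵥ fun q₀ => T (s q₀) p) p₀‖ ^ 2 := by
            rw [sum_fin_succ_pi, Finset.sum_comm]
            simp only [tensorProd_mulVec_cons]
            rfl
        _ ≤ ∑ p : Fin N → P,
            (c * ∑ q₀, ‖T (fun q => s q₀ q - e q₀ * w q) p‖ ^ 2 + ‖T w p‖ ^ 2) := by
            refine Finset.sum_le_sum fun p _ => (hr _).trans (le_of_eq ?_)
            rw [sum_normSq_eq_add he fun q₀ => T (s q₀) p]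
            simp only [hTw, hTs]
            ring
        _ = c * ∑ q₀, ∑ p, ‖T (fun q => s q₀ q - e q₀ * w q) p‖ ^ 2 + ∑ p, ‖T w p‖ ^ 2 := by
            rw [Finset.sum_add_distrib, ← Finset.mul_sum, Finset.sum_comm]
        _ ≤ _ := by
            exact add_le_add_left (mul_le_mul_of_nonneg_left
              (Finset.sum_le_sum fun q₀ _ => (ih _).1) hc0) _
    have hpos : 0 ≤ ∑ q₀, ∑ q, ‖s q₀ q - e q₀ * w q‖ ^ 2 := by positivity
    rw [hw, hx]
    constructor
    · nlinarith [(ih w).1]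
    · linarith [(ih w).2]

/-- A linear map on `d × d` matrices as a matrix acting on vectors indexed by pairs. -/
theorem linearMap_apply_eq_mulVec {d : Type*} [Fintype d] [DecidableEq d]
    (R : Matrix d d ℂ →ₗ[ℂ] Matrix d d ℂ) (X : Matrix d d ℂ) (p : d × d) :
    R X p.1 p.2 = ((Matrix.of fun p q : d × d => R (Matrix.single q.1 q.2 1) p.1 p.2) *ᵥ
      fun q => X q.1 q.2) p := by
  conv_lhs => rw [Matrix.matrix_eq_sum_single X]
  simp only [map_sum, Matrix.sum_apply, mulVec, dotProduct, Fintype.sum_prod_type, Matrix.of_apply]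
  refine Finset.sum_congr rfl fun a _ => Finset.sum_congr rfl fun b _ => ?_
  rw [← mul_one (X a b), ← smul_eq_mul (X a b), ← Matrix.smul_single, map_smul, Matrix.smul_apply,
    smul_eq_mul, smul_eq_mul, mul_one, mul_comm]

/-- If `R` satisfies `‖R X‖₂² ≤ c ‖X‖₂² + (1 - c) |⟨e, X⟩|²` for the unit vector `e = I/√(dim)`,
then `R^{⊗N}` contracts the squared Hilbert–Schmidt norm of traceless operators by `c`. -/
theorem hilbertSchmidtNorm_tensorPower_sq_le {d : Type*} [Fintype d] [DecidableEq d] [Nonempty d]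
    {R : Matrix d d ℂ →ₗ[ℂ] Matrix d d ℂ} {c : ℝ} (hc0 : 0 ≤ c) (hc1 : c ≤ 1)
    (hR : ∀ X, hilbertSchmidtNorm (R X) ^ 2 ≤
      c * hilbertSchmidtNorm X ^ 2 + (1 - c) * (‖X.trace‖ ^ 2 / Fintype.card d))
    {N : ℕ} {X : Matrix (Fin N → d) (Fin N → d) ℂ} (hX : X.trace = 0) :
    hilbertSchmidtNorm (tensorPower N R X) ^ 2 ≤ c * hilbertSchmidtNorm X ^ 2 := by
  let r : Matrix (d × d) (d × d) ℂ :=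
    Matrix.of fun p q => R (Matrix.single q.1 q.2 1) p.1 p.2
  -- `e` is the identity matrix divided by its Hilbert–Schmidt norm, so `⟨e, X⟩ = t * Tr X`.
  let t : ℂ := ((√(Fintype.card d))⁻¹ : ℝ)
  have ht : ‖t‖ ^ 2 = (Fintype.card d : ℝ)⁻¹ := by
    simp [t, Complex.norm_real]
  let e (p : d × d) : ℂ := if p.1 = p.2 then t else 0
  have he : ∑ p, ‖e p‖ ^ 2 = 1 := by
    simp [e, Fintype.sum_prod_type, apply_ite norm, ite_pow, ht]
  have hr (z : d × d → ℂ) : ∑ p, ‖(r *ᵥ z) p‖ ^ 2 ≤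
      c * ∑ p, ‖z p‖ ^ 2 + (1 - c) * ‖∑ q, star (e q) * z q‖ ^ 2 := by
    have h := hR (Matrix.of fun a b => z (a, b))
    simp only [hilbertSchmidtNorm_sq, ← Fintype.sum_prod_type',
      linearMap_apply_eq_mulVec R (Matrix.of fun a b => z (a, b))] at h
    have htr : ∑ q, star (e q) * z q = star t * (Matrix.of fun a b => z (a, b)).trace := by
      simp [e, Fintype.sum_prod_type, Matrix.trace, Finset.mul_sum, apply_ite]
    rw [htr, norm_mul, mul_pow, norm_star, ht, inv_mul_eq_div]
    exact h
  let ε := Equiv.arrowProdEquivProdArrow (Fin N) (fun _ => d) (fun _ => d)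
  have h := (sum_normSq_tensorProd_mulVec_le he hc0 hc1 hr N fun q => X (ε q).1 (ε q).2).2
  have hT (p : Fin N → d × d) :
      (tensorProd (fun _ : Fin N => r) *ᵥ fun q => X (ε q).1 (ε q).2) p =
        tensorPower N R X (ε p).1 (ε p).2 := by
    simp only [tensorPower, LinearMap.coe_mk, AddHom.coe_mk, Matrix.sum_apply, Matrix.smul_apply]
    rw [← Fintype.sum_prod_type', ← ε.sum_comp]
    simp only [mulVec, dotProduct, tensorProd, r, Matrix.of_apply, smul_eq_mul]
    exact Finset.sum_congr rfl fun q _ => mul_comm _ _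
  have htr : ∑ q : Fin N → d × d, (∏ l, star (e (q l))) * X (ε q).1 (ε q).2 = 0 := by
    have h1 (q : Fin N → d × d) :
        ∏ l, star (e (q l)) = if (ε q).1 = (ε q).2 then star t ^ N else 0 := by
      simp only [e, apply_ite star, star_zero, Finset.prod_ite_zero, ε, funext_iff]
      simp only [Equiv.arrowProdEquivProdArrow, Equiv.coe_fn_mk, Finset.mem_univ, true_imp_iff,
        Finset.prod_const, Finset.card_univ, Fintype.card_fin]
      congr
    simp only [h1]
    rw [ε.sum_comp fun q => (if q.1 = q.2 then star t ^ N else 0) * X q.1 q.2,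
      Fintype.sum_prod_type]
    have : ∑ a, X a a = 0 := hX
    simp [← Finset.mul_sum, this]
  simp only [hT, htr] at h
  rw [ε.sum_comp fun p => ‖tensorPower N R X p.1 p.2‖ ^ 2, ε.sum_comp fun p => ‖X p.1 p.2‖ ^ 2] at h
  simpa [hilbertSchmidtNorm_sq, Fintype.sum_prod_type] using h

/-! ### Contractivity of qubit channels in Hilbert–Schmidt norm -/

theorem hilbertSchmidtNorm_smul_sq {d : Type*} [Fintype d] (c : ℂ) (A : Matrix d d ℂ) :
    hilbertSchmidtNorm (c • A) ^ 2 = ‖c‖ ^ 2 * hilbertSchmidtNorm A ^ 2 := by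
  simp [hilbertSchmidtNorm_sq, mul_pow, Finset.mul_sum]

theorem hilbertSchmidtNorm_nonneg {d : Type*} [Fintype d] (A : Matrix d d ℂ) :
    0 ≤ hilbertSchmidtNorm A :=
  @norm_nonneg _ (Matrix.frobeniusNormedAddCommGroup.toSeminormedAddCommGroup.toSeminormedAddGroup)
    A

theorem hilbertSchmidtNorm_smul_one_add_sq {d : Type*} [Fintype d] [DecidableEq d] (c : ℂ)
    {A : Matrix d d ℂ} (hA : A.trace = 0) :
    hilbertSchmidtNorm (c • 1 + A) ^ 2 =
      ‖c‖ ^ 2 * Fintype.card d + hilbertSchmidtNorm A ^ 2 := by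
  apply Complex.ofReal_injective
  rw [hilbertSchmidtNorm_sq_eq_trace, Complex.ofReal_add, hilbertSchmidtNorm_sq_eq_trace]
  simp [add_mul, mul_add, Matrix.trace_add, Matrix.trace_smul, hA, Matrix.trace_conjTranspose,
    ← Complex.conj_mul']
  ring

theorem hilbertSchmidtNorm_add_I_smul_sq {d : Type*} [Fintype d] {A B : Matrix d d ℂ}
    (hA : A.IsHermitian) (hB : B.IsHermitian) :
    hilbertSchmidtNorm (A + Complex.I • B) ^ 2 =
      hilbertSchmidtNorm A ^ 2 + hilbertSchmidtNorm B ^ 2 := by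
  apply Complex.ofReal_injective
  rw [hilbertSchmidtNorm_sq_eq_trace, Complex.ofReal_add, hilbertSchmidtNorm_sq_eq_trace,
    hilbertSchmidtNorm_sq_eq_trace]
  simp [add_mul, mul_add, Matrix.trace_add, Matrix.trace_smul, hA.eq, hB.eq,
    Matrix.trace_mul_comm B A, ← mul_assoc]

theorem mul_self_of_isHermitian_of_trace_eq_zero {A : Matrix (Fin 2) (Fin 2) ℂ}
    (hA : A.IsHermitian) (htr : A.trace = 0) :
    A * A = ((hilbertSchmidtNorm A ^ 2 / 2 : ℝ) : ℂ) • 1 := by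
  have h11 : A 1 1 = -A 0 0 := by
    rw [Matrix.trace_fin_two] at htr
    linear_combination htr
  have h00 : starRingEnd ℂ (A 0 0) = A 0 0 := hA.apply 0 0
  have h10 := hA.apply 1 0
  rw [hilbertSchmidtNorm_sq]
  ext i j
  fin_cases i <;> fin_cases j <;>
    simp [Matrix.mul_apply, Fin.sum_univ_two, h11, ← h10, h00, ← Complex.conj_mul']
  all_goals ring

/-- A traceless Hermitian `2 × 2` matrix has eigenvalues `±a`, so the trace and Hilbert–Schmidt norms
are proportional on such matrices. -/
theorem traceNorm_of_isHermitian_of_trace_eq_zero {A : Matrix (Fin 2) (Fin 2) ℂ}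
    (hA : A.IsHermitian) (htr : A.trace = 0) :
    traceNorm A = √2 * hilbertSchmidtNorm A := by
  have h : A.conjTranspose * A =
      algebraMap ℝ (Matrix (Fin 2) (Fin 2) ℂ) (hilbertSchmidtNorm A ^ 2 / 2) := by
    rw [hA.eq, mul_self_of_isHermitian_of_trace_eq_zero hA htr, Algebra.algebraMap_eq_smul_one,
      Complex.coe_smul]
  rw [traceNorm, h, cfc_algebraMap, Algebra.algebraMap_eq_smul_one, Matrix.trace_smul,
    Real.sqrt_div (sq_nonneg _), Real.sqrt_sq (hilbertSchmidtNorm_nonneg A)]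
  simp only [trace_one, Fintype.card_fin, Complex.smul_re, smul_eq_mul]
  norm_num
  field_simp
  rw [Real.sq_sqrt (by norm_num)]

/-- A traceless Hermitian matrix is a multiple of the difference of a pure state and the maximally
mixed state, so contractivity on states, which is in trace norm, carries over. -/
theorem IsStrictlyContractiveWith.hilbertSchmidtNorm_hermitian_le
    {R : Matrix (Fin 2) (Fin 2) ℂ →ₗ[ℂ] Matrix (Fin 2) (Fin 2) ℂ} {k : ℝ}
    (hR : IsBistochastic R) (hk : IsStrictlyContractiveWith R k)
    {A : Matrix (Fin 2) (Fin 2) ℂ} (hA : A.IsHermitian) (htr : A.trace = 0) :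
    hilbertSchmidtNorm (R A) ^ 2 ≤ k ^ 2 * hilbertSchmidtNorm A ^ 2 := by
  obtain h0 | hpos := (hilbertSchmidtNorm_nonneg A).eq_or_lt
  · have hA0 : A = 0 := by
      let _ := Matrix.frobeniusNormedAddCommGroup (m := Fin 2) (n := Fin 2) (α := ℂ)
      exact norm_eq_zero.1 h0.symm
    simp [hA0, hilbertSchmidtNorm_sq]
  -- The scaling for which `(s • A)² = 1`, so that `P = (1 + s • A) / 2` is a projection of rank one.
  let s : ℝ := √2 * (hilbertSchmidtNorm A)⁻¹
  have hs : s ^ 2 * (hilbertSchmidtNorm A ^ 2 / 2) = 1 := by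
    simp only [s, mul_pow, Real.sq_sqrt zero_le_two]
    field_simp
  have hs0 : s ≠ 0 := by rintro h; simp [h] at hs
  let P : Matrix (Fin 2) (Fin 2) ℂ := (1 / 2 : ℂ) • (1 + (s : ℂ) • A)
  have hPH : P.conjTranspose = P := by
    simp [P, Matrix.conjTranspose_smul, hA.eq]
  have hAA : ((s : ℂ) • A) * ((s : ℂ) • A) = 1 := by
    have h1 : (s : ℂ) * s * ((hilbertSchmidtNorm A ^ 2 / 2 : ℝ) : ℂ) = 1 := by
      rw [← sq]
      exact_mod_cast hs
    rw [Matrix.smul_mul, Matrix.mul_smul, mul_self_of_isHermitian_of_trace_eq_zero hA htr,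
      smul_smul, smul_smul, h1, one_smul]
  have hPP : P.conjTranspose * P = P := by
    rw [hPH]
    simp only [P]
    generalize (s : ℂ) • A = Q at hAA
    simp only [Matrix.smul_mul, Matrix.mul_smul, add_mul, mul_add, one_mul, mul_one, hAA]
    module
  have hP : IsState P := by
    refine ⟨hPP ▸ Matrix.posSemidef_conjTranspose_mul_self P, ?_⟩
    simp [P, Matrix.trace_add, Matrix.trace_smul, htr]
  have hσ : IsState ((1 / 2 : ℂ) • (1 : Matrix (Fin 2) (Fin 2) ℂ)) := by
    refine ⟨Matrix.PosSemidef.one.smul (by norm_num [Complex.le_def]), ?_⟩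
    simp [Matrix.trace_smul]
  have hdiff : P - (1 / 2 : ℂ) • 1 = ((s / 2 : ℝ) : ℂ) • A := by
    simp only [P]
    push_cast
    module
  have hherm {B : Matrix (Fin 2) (Fin 2) ℂ} (hB : B.IsHermitian) :
      (((s / 2 : ℝ) : ℂ) • B).IsHermitian := by
    simp [Matrix.IsHermitian, Matrix.conjTranspose_smul, hB.eq]
  have hRA : (R A).IsHermitian := by
    rw [Matrix.IsHermitian, ← hR.completelyPositive.map_conjTranspose, hA.eq]
  have hRtr : (R A).trace = 0 := (hR.trace_preserving A).trans htr
  have h := hk.contract _ _ hP hσ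
  rw [← map_sub, hdiff, map_smul,
    traceNorm_of_isHermitian_of_trace_eq_zero (hherm hA) (by simp [Matrix.trace_smul, htr]),
    traceNorm_of_isHermitian_of_trace_eq_zero (hherm hRA) (by simp [Matrix.trace_smul, hRtr]),
    mul_left_comm] at h
  have h2 := pow_le_pow_left₀ (hilbertSchmidtNorm_nonneg _)
    (le_of_mul_le_mul_left h (by positivity)) 2
  rw [mul_pow, hilbertSchmidtNorm_smul_sq, hilbertSchmidtNorm_smul_sq, mul_left_comm] at h2
  refine le_of_mul_le_mul_left h2 (pow_pos (norm_pos_iff.2 ?_) 2)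
  exact_mod_cast div_ne_zero hs0 two_ne_zero

theorem IsStrictlyContractiveWith.hilbertSchmidtNorm_traceless_le
    {R : Matrix (Fin 2) (Fin 2) ℂ →ₗ[ℂ] Matrix (Fin 2) (Fin 2) ℂ} {k : ℝ}
    (hR : IsBistochastic R) (hk : IsStrictlyContractiveWith R k)
    {X : Matrix (Fin 2) (Fin 2) ℂ} (htr : X.trace = 0) :
    hilbertSchmidtNorm (R X) ^ 2 ≤ k ^ 2 * hilbertSchmidtNorm X ^ 2 := by
  -- `A` and `B` are the Hermitian real and imaginary parts of `X`.
  let A : Matrix (Fin 2) (Fin 2) ℂ := (1 / 2 : ℂ) • (X + X.conjTranspose)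
  let B : Matrix (Fin 2) (Fin 2) ℂ := (Complex.I / 2) • (X.conjTranspose - X)
  have hA : A.IsHermitian := by
    simp [A, Matrix.IsHermitian, Matrix.conjTranspose_smul, add_comm]
  have hB : B.IsHermitian := by
    simp [B, Matrix.IsHermitian, Matrix.conjTranspose_smul, neg_div]
    module
  have hAB : X = A + Complex.I • B := by
    simp only [A, B, smul_smul, ← mul_div_assoc, Complex.I_mul_I]
    module
  have hAtr : A.trace = 0 := by
    simp [A, Matrix.trace_smul, Matrix.trace_add, Matrix.trace_conjTranspose, htr]
  have hBtr : B.trace = 0 := by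
    simp [B, Matrix.trace_smul, Matrix.trace_sub, Matrix.trace_conjTranspose, htr]
  have hRH {Y : Matrix (Fin 2) (Fin 2) ℂ} (hY : Y.IsHermitian) : (R Y).IsHermitian := by
    rw [Matrix.IsHermitian, ← hR.completelyPositive.map_conjTranspose, hY.eq]
  rw [hAB, map_add, R.map_smul Complex.I B, hilbertSchmidtNorm_add_I_smul_sq hA hB,
    hilbertSchmidtNorm_add_I_smul_sq (hRH hA) (hRH hB), mul_add]
  exact add_le_add (hk.hilbertSchmidtNorm_hermitian_le hR hA hAtr)
    (hk.hilbertSchmidtNorm_hermitian_le hR hB hBtr)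

/-- The contraction bound for arbitrary matrices: `R` fixes multiples of the identity and contracts
their orthogonal complement, the traceless matrices. -/
theorem IsStrictlyContractiveWith.hilbertSchmidtNorm_le
    {R : Matrix (Fin 2) (Fin 2) ℂ →ₗ[ℂ] Matrix (Fin 2) (Fin 2) ℂ} {k : ℝ}
    (hR : IsBistochastic R) (hk : IsStrictlyContractiveWith R k)
    (X : Matrix (Fin 2) (Fin 2) ℂ) :
    hilbertSchmidtNorm (R X) ^ 2 ≤ k ^ 2 * hilbertSchmidtNorm X ^ 2 +
      (1 - k ^ 2) * (‖X.trace‖ ^ 2 / Fintype.card (Fin 2)) := by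
  let t : ℂ := X.trace / 2
  let Y := X - t • 1
  have hX : X = t • 1 + Y := by simp [Y]
  have hY : Y.trace = 0 := by
    simp [Y, t, Matrix.trace_sub, Matrix.trace_smul]
  have h := hk.hilbertSchmidtNorm_traceless_le hR hY
  have ht : ‖X.trace‖ ^ 2 / Fintype.card (Fin 2) = ‖t‖ ^ 2 * Fintype.card (Fin 2) := by
    simp [t]
    ring
  rw [ht]
  conv_lhs => rw [hX]
  conv_rhs => rw [hX]
  rw [map_add, map_smul, hR.map_one, hilbertSchmidtNorm_smul_one_add_sq t hY,
    hilbertSchmidtNorm_smul_one_add_sq t ((hR.trace_preserving Y).trans hY)]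
  linarith

end QuantumChannel

/-! ### Entropy production -/

theorem mainTheorem7 (N : ℕ) (R : Matrix (Fin 2) (Fin 2) ℂ →ₗ[ℂ] Matrix (Fin 2) (Fin 2) ℂ) (k : ℝ)
    (hR : QuantumChannel.IsBistochastic R) (hk : QuantumChannel.IsStrictlyContractiveWith R k)
    (ρ : Matrix (Fin N → Fin 2) (Fin N → Fin 2) ℂ) (hρ : QuantumChannel.IsState ρ)
    (n : ℕ) (hn : 1 ≤ n) :
    QuantumChannel.vonNeumannEntropy ((QuantumChannel.tensorPower N R)^[n] ρ) -
        QuantumChannel.vonNeumannEntropy ρ ≥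
      (1 - k ^ (2 * n)) / 2 *
        QuantumChannel.hilbertSchmidtNorm (ρ - ((1 : ℂ) / 2 ^ N) • 1) ^ 2 := by
  open QuantumChannel ComplexOrder in
  have hT1 : tensorPower N R 1 = 1 := tensorPower_one N hR.map_one
  have hTtr := trace_tensorPower N hR.trace_preserving
  -- Every power of `T` is unital, trace-preserving and positive, and contracts traceless operators.
  have key (m : ℕ) : ((tensorPower N R ^ m) 1 = 1) ∧
      (∀ X, ((tensorPower N R ^ m) X).trace = X.trace) ∧
      (∀ X : Matrix (Fin N → Fin 2) (Fin N → Fin 2) ℂ, X.PosSemidef →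
        ((tensorPower N R ^ m) X).PosSemidef) ∧
      (∀ X, X.trace = 0 → hilbertSchmidtNorm ((tensorPower N R ^ m) X) ^ 2 ≤
        k ^ (2 * m) * hilbertSchmidtNorm X ^ 2) := by
    induction m with
    | zero => simp
    | succ m ih =>
      obtain ⟨h1, h2, h3, h4⟩ := ih
      rw [pow_succ' (tensorPower N R) m]
      simp only [Module.End.mul_apply]
      refine ⟨by rw [h1, hT1], fun X => by rw [hTtr, h2],
        fun X hX => hR.completelyPositive.tensorPower_posSemidef (h3 X hX), fun X hX => ?_⟩
      calc _ ≤ k ^ 2 * hilbertSchmidtNorm ((tensorPower N R ^ m) X) ^ 2 :=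
            hilbertSchmidtNorm_tensorPower_sq_le (sq_nonneg k)
              (pow_le_one₀ hk.nonneg hk.lt_one.le) (hk.hilbertSchmidtNorm_le hR)
              ((h2 X).trans hX)
        _ ≤ k ^ 2 * (k ^ (2 * m) * hilbertSchmidtNorm X ^ 2) :=
            mul_le_mul_of_nonneg_left (h4 X hX) (sq_nonneg k)
        _ = _ := by ring
  obtain ⟨h1, h2, h3, h4⟩ := key n
  have hent := vonNeumannEntropy_sub_ge h3 h2 h1 hρ
  have hcard : ((1 : ℂ) / 2 ^ N) = 1 / Fintype.card (Fin N → Fin 2) := by simp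
  have hc := h4 (ρ - ((1 : ℂ) / 2 ^ N) • 1) (by
    rw [hcard]; simp [Matrix.trace_sub, Matrix.trace_smul, hρ.trace_eq_one])
  -- Both `‖ρ‖₂²` and `‖Tⁿ ρ‖₂²` exceed the squared distance to `I / 2^N` by `1 / 2^N`.
  rw [map_sub, map_smul, h1, hcard, hilbertSchmidtNorm_sub_smul_one_sq hρ.trace_eq_one,
    hilbertSchmidtNorm_sub_smul_one_sq ((h2 ρ).trans hρ.trace_eq_one)] at hc
  rw [Module.End.pow_apply] at hent hc
  rw [hcard, hilbertSchmidtNorm_sub_smul_one_sq hρ.trace_eq_one]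
  linarith
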